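/- Let $\mathbb{H}^2$ be the hyperbolic plane (curvature $-1$) with distance $\delta$, and let $r>0$ and $d$ be real numbers. A graph $G=(V,E)$ is called $(r,d)$-hyperbolic if there is a map $m:V\to\mathbb{H}^2$ such that - $\delta(m(v_1),m(v_2))>r$ for all $v_1\neq v_2$ in $V$; - $\delta(m(v_1),m(v_2))<d$ for every edge $\{v_1,v_2\}\in E$; - when every edge $\{v_1,v_2\}\in E$ is drawn as the geodesic segment between $m(v_1)$ and $m(v_2)$, the edges do not cross (the segments of two different edges meet at most in the position of a common end vertex), and no point of the segment of $\{v_1,v_2\}$ is at distance less than $r/2$ from $m(w)$ for a vertex $w\notin\{v_1,v_2\}$. Theorem. For all real $r>0$ and $d$ there is a constant $C$, depending only on $r$ and $d$, such that for every finite simple $(r,d)$-hyperbolic graph $G$ with at least two vertices and every $t\in\mathbb{N}$: if $G$ contains the $t\times t$ grid graph as a minor, then $t\le C\log|V(G)|$. That is, $t=O(\log|V(G)|)$. -/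

import Mathlib

open scoped UpperHalfPlane

namespace HyperbolicGrid

/-- The straight line segment between two points of the hyperbolic plane. The hyperbolic plane is
the upper half-plane `ℍ` with its hyperbolic distance `dist` (curvature `-1`). It is uniquely
geodesic, so the points `p` that satisfy the triangle equality with `x` and `y` are exactly
the points of the geodesic segment from `x` to `y`. -/
def segment (x y : ℍ) : Set ℍ :=
  {p | dist x p + dist p y = dist x y}

/-- `m` is a drawing of the graph `G` in the hyperbolic plane that witnesses that `G`
is `(r, d)`-hyperbolic. -/
structure IsHyperbolicDrawing {V : Type*} (G : SimpleGraph V) (r d : ℝ) (m : V → ℍ) : Prop where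
  /-- Distinct vertices are at distance greater than `r`. -/
  separated : ∀ v w : V, v ≠ w → r < dist (m v) (m w)
  /-- Adjacent vertices are at distance less than `d`. -/
  short : ∀ v w : V, G.Adj v w → dist (m v) (m w) < d
  /-- Edges drawn as straight line segments do not cross: the segments of two different edges have
  no common point, except for the position of a common end vertex. -/
  noncrossing : ∀ a b a' b' : V, G.Adj a b → G.Adj a' b' → s(a, b) ≠ s(a', b') →
    ∀ p : ℍ, p ∈ segment (m a) (m b) → p ∈ segment (m a') (m b') →
      ∃ v : V, v ∈ s(a, b) ∧ v ∈ s(a', b') ∧ p = m v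
  /-- An edge does not get closer than `r / 2` to a vertex other than its two ends. -/
  clearance : ∀ a b w : V, G.Adj a b → w ≠ a → w ≠ b →
    ∀ p : ℍ, p ∈ segment (m a) (m b) → r / 2 ≤ dist p (m w)

/-- `G` is an `(r, d)`-hyperbolic graph. -/
def IsHyperbolicGraph {V : Type*} (G : SimpleGraph V) (r d : ℝ) : Prop :=
  ∃ m : V → ℍ, IsHyperbolicDrawing G r d m

/-- `H` is a minor of `G`: there are pairwise disjoint branch sets in `G`, one for every
vertex of `H`, each inducing a (nonempty) connected subgraph of `G`, such that the branch sets of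
adjacent vertices of `H` are joined by an edge of `G`. -/
def IsMinor {W V : Type*} (H : SimpleGraph W) (G : SimpleGraph V) : Prop :=
  ∃ B : W → Set V,
    (∀ x, (G.induce (B x)).Connected) ∧
    (∀ x y, x ≠ y → Disjoint (B x) (B y)) ∧
    (∀ x y, H.Adj x y → ∃ v ∈ B x, ∃ w ∈ B y, G.Adj v w)

/-- The `t × t` grid graph. -/
def grid (t : ℕ) : SimpleGraph (Fin t × Fin t) :=
  SimpleGraph.boxProd (SimpleGraph.pathGraph t) (SimpleGraph.pathGraph t)

end HyperbolicGrid

/-! A balanced separator of size `O(log n)` is found along a geodesic. Pick one vertex in each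
branch set. The lift `(x, y) ↦ (x, x² + y²)` turns geodesics into lines, so a planar centerpoint
yields a point, normalized to `(0, 1)`, such that each semicircle through it with center `(s, 0)`
has at most 2/3 of the picked vertices on either side (`exists_hyperbolic_center`).

Edges are short, so an edge leaving the disc has its inner end near the circle
(`near_circle_of_crossing`); these near vertices form the separator. By pigeonhole, some `s` in `[0,
1]` has all of them at height at least of order `1 / n` (`exists_circle_avoiding_low_points`). They
then occupy `O(log n)` height bands of fixed ratio, each holding `O(1)` separated points
(`card_near_circle_le`). In a `t × t` grid minor such a separator needs `t / 3` vertices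
(`le_three_mul_card_of_balanced`). -/

namespace HyperbolicGrid

open Finset Module

/-! ### Centerpoints -/

/-- **Centerpoint theorem**: a finite family of points in a `d`-dimensional space has a point in its
convex hull such that every open half-space bounded by a hyperplane through that point contains at
most the fraction `d / (d + 1)` of the family. -/
theorem exists_centerpoint {ι E : Type*} [Fintype ι] [Nonempty ι] [AddCommGroup E] [Module ℝ E]
    [FiniteDimensional ℝ E] (f : ι → E) :
    ∃ q ∈ convexHull ℝ (Set.range f), ∀ g : E →ₗ[ℝ] ℝ,
      (finrank ℝ E + 1) * #{i | g q < g (f i)} ≤ finrank ℝ E * Fintype.card ι := by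
  classical
  set d := finrank ℝ E
  let F : Finset (Finset ι) := {T | d * Fintype.card ι < (d + 1) * #T}
  have key : (⋂ T ∈ F, convexHull ℝ (f '' (T : Set ι))).Nonempty := by
    refine Convex.helly_theorem' (𝕜 := ℝ) (fun T _ => convex_convexHull ℝ _) ?_
    intro I hI hcard
    -- Each complement has fewer than `n / (d + 1)` indices, so `d + 1` of them cannot cover `ι`; an
    -- uncovered index gives the common point for Helly.
    have hcompl : #(I.biUnion fun T => Tᶜ) < Fintype.card ι := by
      have h1 : (d + 1) * #(I.biUnion fun T => Tᶜ) ≤ ∑ T ∈ I, (d + 1) * #Tᶜ := by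
        rw [← Finset.mul_sum]
        exact Nat.mul_le_mul_left _ card_biUnion_le
      have h2 : ∀ T ∈ I, (d + 1) * #Tᶜ + 1 ≤ Fintype.card ι := by
        intro T hT
        have := (mem_filter.1 (hI hT)).2
        have h3 := card_add_card_compl T
        nlinarith
      have h3 : ∑ T ∈ I, (d + 1) * #Tᶜ ≤ (d + 1) * (Fintype.card ι - 1) :=
        (Finset.sum_le_card_nsmul _ _ _ fun T hT => Nat.le_sub_one_of_lt (h2 T hT)).trans
          (by rw [smul_eq_mul]; exact Nat.mul_le_mul_right _ hcard)
      have h4 := Nat.le_of_mul_le_mul_left (h1.trans h3) (Nat.succ_pos d)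
      have := Fintype.card_pos (α := ι)
      omega
    obtain ⟨i, hi⟩ : ∃ i, i ∉ I.biUnion fun T => Tᶜ := by
      by_contra! h
      rw [eq_univ_iff_forall.2 h, card_univ] at hcompl
      exact hcompl.false
    refine ⟨f i, Set.mem_iInter₂.2 fun T hT => subset_convexHull ℝ _ ⟨i, ?_, rfl⟩⟩
    by_contra hiT
    exact hi (mem_biUnion.2 ⟨T, hT, mem_compl.2 hiT⟩)
  obtain ⟨q, hq⟩ := key
  rw [Set.mem_iInter₂] at hq
  refine ⟨q, ?_, fun g => ?_⟩
  · have := hq univ (by simp [F, Fintype.card_pos])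
    simpa using this
  · by_contra! h
    have hmem := hq {i | g q < g (f i)} (mem_filter.2 ⟨mem_univ _, h⟩)
    have hconv : Convex ℝ {p | g q < g p} := convex_halfSpace_gt g.isLinear _
    have : q ∈ {p | g q < g p} := by
      refine convexHull_min ?_ hconv hmem
      rintro _ ⟨i, hi, rfl⟩
      simpa using hi
    exact lt_irrefl (g q) this

/-! ### Balanced separators of grid minors -/

/-- A predicate that is invariant along the edges of a connected graph is constant. -/
theorem iff_of_connected {V : Type*} {G : SimpleGraph V} (hG : G.Connected) {P : V → Prop}
    (h : ∀ a b, G.Adj a b → (P a ↔ P b)) (a b : V) : P a ↔ P b := by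
  obtain ⟨p⟩ := hG.preconnected a b
  induction p with
  | nil => rfl
  | cons hadj _ ih => exact (h _ _ hadj).trans ih

/-- A set of vertices that separates, in a graph with a `t × t` grid minor, a set of representatives
of the branch sets into parts of at most two thirds has at least `t / 3` elements. -/
theorem le_three_mul_card_of_balanced {V : Type*} {G : SimpleGraph V} {t : ℕ}
    {B : Fin t × Fin t → Set V} (hconn : ∀ x, (G.induce (B x)).Connected)
    (hdisj : ∀ x y, x ≠ y → Disjoint (B x) (B y))
    (hadj : ∀ x y, (grid t).Adj x y → ∃ v ∈ B x, ∃ w ∈ B y, G.Adj v w)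
    {w : Fin t × Fin t → V} (hw : ∀ x, w x ∈ B x) (S : Finset V) (P : V → Prop) [DecidablePred P]
    [DecidableEq V] (hP : ∀ a b, a ∉ S → b ∉ S → G.Adj a b → (P a ↔ P b))
    (hpos : 3 * #{x | w x ∉ S ∧ P (w x)} ≤ 2 * t ^ 2)
    (hneg : 3 * #{x | w x ∉ S ∧ ¬ P (w x)} ≤ 2 * t ^ 2) : t ≤ 3 * #S := by
  classical
  let bad : Fin t × Fin t → Prop := fun x => ∃ v ∈ B x, v ∈ S
  -- Used for both projections: disjoint branch sets force distinct bad lines to use distinct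
  -- vertices of `S`.
  have bad_card : ∀ (π : Fin t × Fin t → Fin t),
      #{i | ∃ x, π x = i ∧ bad x} ≤ #S := by
    intro π
    have hex : ∀ i : Fin t, ∃ v, (∃ x, π x = i ∧ bad x) → v ∈ S ∧ ∃ x, π x = i ∧ v ∈ B x := by
      intro i
      by_cases h : ∃ x, π x = i ∧ bad x
      · obtain ⟨x, hx, v, hv, hvS⟩ := h
        exact ⟨v, fun _ => ⟨hvS, x, hx, hv⟩⟩
      · exact ⟨w (i, i), fun h' => absurd h' h⟩
    choose φ hφ using hex
    refine card_le_card_of_injOn φ (fun i hi => (hφ i (mem_filter.1 hi).2).1) ?_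
    intro i hi j hj hij
    obtain ⟨x, hx, hvx⟩ := (hφ i (mem_filter.1 hi).2).2
    obtain ⟨y, hy, hvy⟩ := (hφ j (mem_filter.1 hj).2).2
    rw [← hx, ← hy]
    by_contra hne
    have hxy : x ≠ y := fun h => hne (by rw [h])
    exact Set.disjoint_left.1 (hdisj x y hxy) hvx (hij ▸ hvy)
  by_contra! hlt
  have good_row : ∃ c, c ∉ ({i | ∃ x : Fin t × Fin t, x.2 = i ∧ bad x} : Finset (Fin t)) := by
    by_contra! h
    have := bad_card Prod.snd
    rw [eq_univ_iff_forall.2 h, card_univ, Fintype.card_fin] at this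
    omega
  obtain ⟨c, hc⟩ := good_row
  simp only [mem_filter, mem_univ, true_and, not_exists, not_and] at hc
  have inside : ∀ x, ¬ bad x → ∀ v ∈ B x, ∀ v' ∈ B x, (P v ↔ P v') := by
    intro x hx v hv v' hv'
    refine iff_of_connected (hconn x) (P := fun u => P u) ?_ ⟨v, hv⟩ ⟨v', hv'⟩
    rintro ⟨a, ha⟩ ⟨b, hb⟩ hab
    exact hP a b (fun h => hx ⟨a, ha, h⟩) (fun h => hx ⟨b, hb, h⟩) hab
  have step : ∀ x y, ¬ bad x → ¬ bad y → (grid t).Adj x y → (P (w x) ↔ P (w y)) := by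
    intro x y hx hy hxy
    obtain ⟨v, hv, v', hv', hvv⟩ := hadj x y hxy
    rw [inside x hx _ (hw x) _ hv, inside y hy _ (hw y) _ hv']
    exact hP v v' (fun h => hx ⟨v, hv, h⟩) (fun h => hy ⟨v', hv', h⟩) hvv
  have hpath : (SimpleGraph.pathGraph t).Connected := by
    obtain ⟨k, rfl⟩ : ∃ k, t = k + 1 := ⟨t - 1, by omega⟩
    exact SimpleGraph.pathGraph_connected k
  -- The clean line with second coordinate `c` meets every clean line of `R`, so all of these lie on
  -- one side of `P`; they contain more than 2/3 of the grid.
  have column : ∀ i i' : Fin t, P (w (i, c)) ↔ P (w (i', c)) :=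
    iff_of_connected (P := fun i => P (w (i, c))) hpath fun a b hab =>
      step _ _ (hc _ rfl) (hc _ rfl) (Or.inl ⟨hab, rfl⟩)
  let R : Finset (Fin t) := ({i | ∃ x : Fin t × Fin t, x.1 = i ∧ bad x} : Finset (Fin t))ᶜ
  have hR : ∀ i ∈ R, ∀ j, ¬ bad (i, j) := by
    intro i hi j hbad
    simp only [R, mem_compl, mem_filter, mem_univ, true_and, not_exists, not_and] at hi
    exact hi _ rfl hbad
  have hRcard : t ≤ #R + #S := by
    have h1 := bad_card Prod.fst
    have h2 : #R + _ = _ := card_compl_add_card _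
    rw [Fintype.card_fin] at h2
    omega
  have row : ∀ i ∈ R, ∀ j j', P (w (i, j)) ↔ P (w (i, j')) := fun i hi =>
    iff_of_connected (P := fun j => P (w (i, j))) hpath fun a b hab =>
      step _ _ (hR i hi _) (hR i hi _) (Or.inr ⟨hab, rfl⟩)
  have hall : ∀ x ∈ R ×ˢ (univ : Finset (Fin t)),
      w x ∉ S ∧ (P (w x) ↔ P (w (c, c))) := by
    rintro ⟨i, j⟩ hx
    have hi := (mem_product.1 hx).1
    exact ⟨fun h => hR i hi j ⟨_, hw _, h⟩, (row i hi j c).trans (column i c)⟩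
  have hcardR : 3 * (#R * t) ≤ 2 * t ^ 2 := by
    have hprod : #(R ×ˢ (univ : Finset (Fin t))) = #R * t := by
      rw [card_product, card_univ, Fintype.card_fin]
    rw [← hprod]
    by_cases hPc : P (w (c, c))
    · refine (Nat.mul_le_mul_left 3 (card_le_card fun x hx => ?_)).trans hpos
      exact mem_filter.2 ⟨mem_univ _, (hall x hx).1, (hall x hx).2.2 hPc⟩
    · refine (Nat.mul_le_mul_left 3 (card_le_card fun x hx => ?_)).trans hneg
      exact mem_filter.2 ⟨mem_univ _, (hall x hx).1, fun h => hPc ((hall x hx).2.1 h)⟩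
  nlinarith

/-! ### Vertices near a circle through `(0, 1)` -/

/-- The number of points in an interval of length `L` with mutual distances at least `δ`. -/
theorem card_le_of_separated {ι : Type*} (T : Finset ι) (x : ι → ℝ) {a L δ : ℝ} (hδ : 0 < δ)
    (hx : ∀ i ∈ T, a ≤ x i ∧ x i ≤ a + L)
    (hsep : ∀ i ∈ T, ∀ j ∈ T, i ≠ j → δ ≤ |x i - x j|) : #T ≤ ⌊L / δ⌋₊ + 1 := by
  rw [← card_range (⌊L / δ⌋₊ + 1)]
  refine card_le_card_of_injOn (fun i => ⌊(x i - a) / δ⌋₊) (fun i hi => ?_) ?_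
  · have := hx i hi
    rw [coe_range, Set.mem_Iio, Nat.lt_succ_iff]
    exact Nat.floor_le_floor (div_le_div_of_nonneg_right (by linarith) hδ.le)
  · intro i hi j hj hij
    by_contra hne
    have h1 := hsep i hi j hj hne
    have hi0 : 0 ≤ (x i - a) / δ := div_nonneg (by linarith [hx i hi]) hδ.le
    have hj0 : 0 ≤ (x j - a) / δ := div_nonneg (by linarith [hx j hj]) hδ.le
    have h2 := Nat.floor_le hi0
    have h3 := Nat.lt_floor_add_one ((x i - a) / δ)
    have h4 := Nat.floor_le hj0
    have h5 := Nat.lt_floor_add_one ((x j - a) / δ)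
    simp only at hij
    rw [hij] at h2 h3
    have h6 : |(x i - a) / δ - (x j - a) / δ| < 1 := abs_sub_lt_iff.2 ⟨by linarith, by linarith⟩
    rw [← sub_div, abs_div, abs_of_pos hδ, div_lt_one hδ] at h6
    rw [show x i - a - (x j - a) = x i - x j by ring] at h6
    linarith

/-- Points `(x i, y i)` of the upper half-plane that are hyperbolically separated, lie at heights
between `τ` and `2`, and are near the circle with center `s` through the point `(0, 1)`:
their number is logarithmic in `1 / τ`. -/
theorem card_near_circle_le {ι : Type*} (T : Finset ι) (x y : ι → ℝ) {ε c τ s : ℝ} (hε : 0 < ε)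
    (hc : 0 < c) (hτ : 0 < τ) (hτ2 : τ ≤ 2)
    (hsep : ∀ i j, i ≠ j → 2 * ε ^ 2 * (y i * y j) ≤ (x i - x j) ^ 2 + (y i - y j) ^ 2)
    (hy : ∀ i ∈ T, τ ≤ y i ∧ y i ≤ 2)
    (hT : ∀ i ∈ T, -(c * y i) ≤ x i ^ 2 - 2 * s * x i - 1 ∧ x i ^ 2 - 2 * s * x i - 1 ≤ 0) :
    (#T : ℝ) ≤ 2 * (⌊c * (1 + ε) / ε⌋₊ + 1) *
      ((Real.log 2 - Real.log τ) / Real.log (1 + ε) + 2) := by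
  classical
  set h := Real.log (1 + ε) with hh
  have hpos : 0 < h := Real.log_pos (by linarith)
  set ρ := Real.sqrt (1 + s ^ 2) with hρ
  have hρ2 : ρ ^ 2 = 1 + s ^ 2 := Real.sq_sqrt (by positivity)
  have hρ1 : 1 ≤ ρ := Real.one_le_sqrt.2 (by nlinarith [sq_nonneg s])
  -- Height bands `[Y, (1 + ε) Y)`, split by the side of the center.
  let row : ι → ℤ × Bool := fun i => (⌊Real.log (y i) / h⌋, decide (s ≤ x i))
  have himage : T.image row ⊆
      Icc ⌊Real.log τ / h⌋ ⌊Real.log 2 / h⌋ ×ˢ (univ : Finset Bool) := by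
    intro p hp
    obtain ⟨i, hi, rfl⟩ := mem_image.1 hp
    obtain ⟨h1, h2⟩ := hy i hi
    refine mem_product.2 ⟨mem_Icc.2 ⟨?_, ?_⟩, mem_univ _⟩
    · exact Int.floor_le_floor (by gcongr)
    · exact Int.floor_le_floor (by gcongr; linarith)
  have hfiber : ∀ b ∈ T.image row, #{i ∈ T | row i = b} ≤ ⌊c * (1 + ε) / ε⌋₊ + 1 := by
    rintro ⟨j, side⟩ -
    set Y := Real.exp (j * h) with hY
    have hYpos : 0 < Y := Real.exp_pos _
    have height : ∀ i ∈ ({i ∈ T | row i = (j, side)} : Finset ι),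
        Y ≤ y i ∧ y i ≤ Y * (1 + ε) := by
      intro i hi
      obtain ⟨hiT, hrow⟩ := mem_filter.1 hi
      have hyi : 0 < y i := hτ.trans_le (hy i hiT).1
      have hfl : ⌊Real.log (y i) / h⌋ = j := congrArg Prod.fst hrow
      obtain ⟨h1, h2⟩ := Int.floor_eq_iff.1 hfl
      rw [le_div_iff₀ hpos] at h1
      rw [div_lt_iff₀ hpos] at h2
      refine ⟨(Real.le_log_iff_exp_le hyi).1 h1, ?_⟩
      have h3 := (Real.log_lt_iff_lt_exp hyi).1 h2
      rw [add_mul, Real.exp_add, one_mul, hh, Real.exp_log (by linarith)] at h3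
      exact h3.le
    have hLδ : c * (1 + ε) / ε = c * ((1 + ε) * Y) / (ε * Y) := by
      field_simp
    rw [hLδ]
    -- Within a band the vertical gap is at most `ε * Y`, which uses up at most half of the squared
    -- separation `2 * (ε * Y) ^ 2`.
    have sep : ∀ i ∈ ({i ∈ T | row i = (j, side)} : Finset ι),
        ∀ k ∈ ({i ∈ T | row i = (j, side)} : Finset ι), i ≠ k → ε * Y ≤ |x i - x k| := by
      intro i hi k hk hik
      obtain ⟨h1, h2⟩ := height i hi
      obtain ⟨h3, h4⟩ := height k hk
      have h5 := hsep i k hik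
      have h6 : Y * Y ≤ y i * y k := mul_le_mul h1 h3 hYpos.le (hYpos.le.trans h1)
      have h7 : (y i - y k) ^ 2 ≤ (ε * Y) ^ 2 := by
        apply sq_le_sq'
        all_goals nlinarith
      have h8 : ε ^ 2 * (Y * Y) ≤ ε ^ 2 * (y i * y k) := by gcongr
      have h9 : (ε * Y) ^ 2 ≤ (x i - x k) ^ 2 := by nlinarith
      calc ε * Y = |ε * Y| := (abs_of_pos (by positivity)).symm
        _ ≤ _ := sq_le_sq.1 h9
    -- As `ρ ≥ 1`, `ρ² - |x i - s|² ≤ c * y i` gives the linear bound `ρ - |x i - s| ≤ c * y i`.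
    have near : ∀ i ∈ ({i ∈ T | row i = (j, side)} : Finset ι),
        |x i - s| ≤ ρ ∧ ρ - c * ((1 + ε) * Y) ≤ |x i - s| := by
      intro i hi
      obtain ⟨h1, h2⟩ := hT i (mem_filter.1 hi).1
      have h3 := (height i hi).2
      have h4 : |x i - s| ^ 2 = (x i - s) ^ 2 := sq_abs _
      have h0 := abs_nonneg (x i - s)
      have h5 : |x i - s| ≤ ρ := by
        apply abs_le_of_sq_le_sq _ (by linarith) |>.trans' (le_of_eq (abs_abs _).symm)
        nlinarith
      refine ⟨h5, ?_⟩
      have h6 : c * y i ≤ c * ((1 + ε) * Y) := by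
        rw [mul_comm (1 + ε)]; gcongr
      nlinarith
    cases side
    · refine card_le_of_separated _ x (a := s - ρ) (by positivity) (fun i hi => ?_) sep
      have hs : ¬ s ≤ x i := by
        have := congrArg Prod.snd (mem_filter.1 hi).2
        simpa [row] using this
      obtain ⟨h1, h2⟩ := near i hi
      rw [abs_of_neg (by linarith)] at h1 h2
      exact ⟨by linarith, by linarith⟩
    · refine card_le_of_separated _ x (a := s + ρ - c * ((1 + ε) * Y)) (by positivity)
        (fun i hi => ?_) sep
      have hs : s ≤ x i := by
        have := congrArg Prod.snd (mem_filter.1 hi).2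
        simpa [row] using this
      obtain ⟨h1, h2⟩ := near i hi
      rw [abs_of_nonneg (by linarith)] at h1 h2
      exact ⟨by linarith, by linarith⟩
  have hcard := card_le_mul_card_image T _ hfiber
  have hrows : (#(T.image row) : ℝ) ≤ 2 * ((Real.log 2 - Real.log τ) / h + 2) := by
    have h1 := card_le_card himage
    rw [card_product, Int.card_Icc, card_univ, Fintype.card_bool] at h1
    have h2 : Real.log τ ≤ Real.log 2 := Real.log_le_log hτ hτ2
    have h3 : ⌊Real.log τ / h⌋ ≤ ⌊Real.log 2 / h⌋ := Int.floor_le_floor (by gcongr)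
    have h4 : ((⌊Real.log 2 / h⌋ + 1 - ⌊Real.log τ / h⌋).toNat : ℝ) =
        ⌊Real.log 2 / h⌋ + 1 - ⌊Real.log τ / h⌋ := by
      have : ((⌊Real.log 2 / h⌋ + 1 - ⌊Real.log τ / h⌋).toNat : ℤ) =
        ⌊Real.log 2 / h⌋ + 1 - ⌊Real.log τ / h⌋ := Int.toNat_of_nonneg (by omega)
      exact_mod_cast this
    have h5 : (#(T.image row) : ℝ) ≤
        ((⌊Real.log 2 / h⌋ + 1 - ⌊Real.log τ / h⌋).toNat : ℝ) * 2 := by exact_mod_cast h1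
    rw [h4] at h5
    have h6 := Int.floor_le (Real.log 2 / h)
    have h7 := Int.lt_floor_add_one (Real.log τ / h)
    rw [sub_div]
    linarith
  calc (#T : ℝ) ≤ (⌊c * (1 + ε) / ε⌋₊ + 1) * #(T.image row) := by exact_mod_cast hcard
    _ ≤ (⌊c * (1 + ε) / ε⌋₊ + 1) * (2 * ((Real.log 2 - Real.log τ) / h + 2)) := by gcongr
    _ = _ := by ring

/-- Among `n` points of the upper half-plane and `n + 1` suitable circles through `(0, 1)` there is
a circle such that none of the points is both low and near the circle. -/
theorem exists_circle_avoiding_low_points {ι : Type*} [Fintype ι] [Nonempty ι] (x y : ι → ℝ)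
    {c : ℝ} (hc : 0 < c) :
    ∃ s : ℝ, 0 ≤ s ∧ s ≤ 1 ∧ ∀ i, -(c * y i) ≤ x i ^ 2 - 2 * s * x i - 1 →
      x i ^ 2 - 2 * s * x i - 1 ≤ 0 → 1 / (4 * c * Fintype.card ι) ≤ y i := by
  set n := Fintype.card ι with hn
  have hnpos : (0 : ℝ) < n := by exact_mod_cast Fintype.card_pos
  have hn1 : (1 : ℝ) ≤ n := by exact_mod_cast Nat.one_le_iff_ne_zero.2 Fintype.card_ne_zero
  by_contra! hcon
  have h01 : ∀ k : Fin (n + 1), 0 ≤ (k : ℝ) / n ∧ (k : ℝ) / n ≤ 1 := fun k =>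
    ⟨by positivity, (div_le_one hnpos).2 (by exact_mod_cast Nat.lt_succ_iff.1 k.2)⟩
  choose φ h1 h2 h3 using fun k : Fin (n + 1) => hcon (k / n) (h01 k).1 (h01 k).2
  -- A low point near two of the circles `s = k / n` has `|u| ≥ 1 / 4`, so the two centers differ by
  -- at most `2 * c * v < 1 / n`.
  have hinj : Function.Injective φ := by
    intro k l hkl
    have a1 := h1 k
    have a2 := h2 k
    have b1 := h1 l
    have b2 := h2 l
    have a3 := h3 k
    obtain ⟨k0, k1⟩ := h01 k
    obtain ⟨l0, l1⟩ := h01 l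
    rw [← hkl] at b1 b2
    rw [lt_div_iff₀ (by positivity)] at a3
    set u := x (φ k)
    set v := y (φ k)
    have a4 : 4 * (c * v) * n < 1 := by linarith
    have a5 : 4 * (c * v) < 1 := by
      by_contra! h
      nlinarith
    have hu : 1 / 4 ≤ |u| := by
      by_contra! h
      obtain ⟨u1, u2⟩ := abs_lt.1 h
      nlinarith [mul_nonneg k0 (by linarith : 0 ≤ u + 1 / 4)]
    have hdiff : |(k : ℝ) / n - l / n| * |u| ≤ c * v / 2 := by
      rw [← abs_mul, abs_le]
      constructor <;> linarith
    have hlt : |(k : ℝ) / n - l / n| * n < 1 := by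
      have hq := abs_nonneg ((k : ℝ) / n - l / n)
      have h5 : |(k : ℝ) / n - l / n| ≤ 2 * (c * v) := by nlinarith
      nlinarith
    rw [← sub_div, abs_div, abs_of_pos hnpos, div_mul_cancel₀ _ hnpos.ne'] at hlt
    have : |(k : ℤ) - (l : ℤ)| < 1 := by exact_mod_cast hlt
    rw [Int.abs_lt_one_iff] at this
    exact Fin.ext (by omega)
  have := Fintype.card_le_of_injective φ hinj
  rw [Fintype.card_fin] at this
  omega

/-! ### Edges crossing the circle -/

/-- If a short edge of the upper half-plane leaves the disc with center `s` and bounding circle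
through `(0, 1)`, its inner end is near that circle. -/
theorem near_circle_of_crossing {x y x' y' s κ : ℝ} (hy : 0 < y) (hκ : 0 ≤ κ)
    (hs0 : 0 ≤ s) (hs1 : s ≤ 1) (hshort : (x - x') ^ 2 + (y - y') ^ 2 ≤ 2 * κ * (y * y'))
    (hin : x ^ 2 + y ^ 2 - 2 * s * x - 1 ≤ 0) (hout : 0 < x' ^ 2 + y' ^ 2 - 2 * s * x' - 1) :
    y ≤ 2 ∧ -(16 * (2 * κ + 2) ^ 2 * y) ≤ x ^ 2 - 2 * s * x - 1 ∧ x ^ 2 - 2 * s * x - 1 ≤ 0 := by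
  have hy2 : y ≤ 2 := by nlinarith [sq_nonneg (x - s)]
  refine ⟨hy2, ?_, by nlinarith⟩
  set e := 2 * κ + 1 with he
  have hdy : |y - y'| ≤ e * y := by
    by_contra! h
    have h1 : y' ≤ y + |y - y'| := by linarith [neg_abs_le (y - y')]
    have h2 : |y - y'| ^ 2 ≤ 2 * κ * (y * (y + |y - y'|)) := by
      rw [sq_abs]
      calc (y - y') ^ 2 ≤ 2 * κ * (y * y') := by nlinarith [sq_nonneg (x - x')]
        _ ≤ _ := by gcongr
    nlinarith [mul_nonneg hκ hy.le, abs_nonneg (y - y')]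
  obtain ⟨hdy1, hdy2⟩ := abs_le.1 hdy
  have hdx2 : (x - x') ^ 2 ≤ ((e + 1) * y) ^ 2 := by
    have h1 : 2 * κ * (y * y') ≤ 2 * κ * (y * (y + e * y)) := by
      gcongr
      linarith
    have h2 : ((e + 1) * y) ^ 2 = 2 * κ * (y * (y + e * y)) + 4 * (κ + 1) * y ^ 2 := by
      rw [he]; ring
    have h3 : 0 ≤ 4 * (κ + 1) * y ^ 2 := by positivity
    linarith [sq_nonneg (y - y')]
  have hdy2' : (y - y') ^ 2 ≤ (e * y) ^ 2 := sq_le_sq' (by linarith) hdy2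
  obtain ⟨hdx, hdx'⟩ := abs_le_of_sq_le_sq' hdx2 (by positivity)
  have hxs : |x - s| ≤ 2 := abs_le_of_sq_le_sq (by nlinarith [sq_nonneg y]) (by norm_num)
  have hprod : |(x' - x) * (x - s)| ≤ (e + 1) * y * 2 := by
    rw [abs_mul]
    gcongr
    exact abs_le.2 ⟨by linarith, by linarith⟩
  have h1 := (abs_le.1 hprod).2
  have h2 : (y' - y) * y ≤ e * y * 2 := by
    have : (y' - y) * y ≤ (e * y) * y := by gcongr; linarith
    have : e * y * y ≤ e * y * 2 := by gcongr
    linarith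
  have h3 : ((e + 1) * y) ^ 2 ≤ 2 * (e + 1) ^ 2 * y := by
    have : y ^ 2 ≤ 2 * y := by nlinarith only [hy, hy2]
    calc ((e + 1) * y) ^ 2 = (e + 1) ^ 2 * y ^ 2 := mul_pow _ _ _
      _ ≤ (e + 1) ^ 2 * (2 * y) := by gcongr
      _ = _ := by ring
  have h4 : (e * y) ^ 2 ≤ 2 * (e + 1) ^ 2 * y := by
    refine le_trans ?_ h3
    have : 0 ≤ e := by positivity
    gcongr
    linarith
  have h5 : y ^ 2 ≤ 2 * y := by nlinarith only [hy, hy2]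
  have h6 : (1 : ℝ) ≤ e := by linarith
  have h7 : 2 * κ + 2 = e + 1 := by linarith
  rw [h7]
  have h8 : (e + 1) * y ≤ (e + 1) ^ 2 * y := by
    gcongr
    exact le_self_pow₀ (by linarith) two_ne_zero
  have h9 : y ≤ (e + 1) ^ 2 * y :=
    le_mul_of_one_le_left hy.le (one_le_pow₀ (by linarith))
  -- The left side is positive, and every term on the right after the first parenthesis is at most a
  -- constant times `y`.
  have h10 : x' ^ 2 + y' ^ 2 - 2 * s * x' - 1 = (x ^ 2 - 2 * s * x - 1) + y ^ 2 + (x - x') ^ 2 +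
      2 * ((x' - x) * (x - s)) + (y - y') ^ 2 + 2 * ((y' - y) * y) := by ring
  have h11 : e * y ≤ (e + 1) * y := by gcongr; linarith
  generalize (e + 1) ^ 2 = Q at *
  generalize (x' - x) * (x - s) = p at *
  generalize (y' - y) * y = p' at *
  linarith

/-! ### The hyperbolic center -/

/-- Finitely many points of the upper half-plane have a center `(a, b)`: if it is moved to `(0, 1)`
by a homothety and a horizontal translation, every geodesic through it whose Euclidean center is `s`
has at most two thirds of the points on either side. -/
theorem exists_hyperbolic_center {ι : Type*} [Fintype ι] [Nonempty ι] (x y : ι → ℝ)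
    (hy : ∀ i, 0 < y i) :
    ∃ a b : ℝ, 0 < b ∧ ∀ s : ℝ,
      3 * #{i | 0 < ((x i - a) / b) ^ 2 + (y i / b) ^ 2 - 2 * s * ((x i - a) / b) - 1} ≤
        2 * Fintype.card ι ∧
      3 * #{i | ((x i - a) / b) ^ 2 + (y i / b) ^ 2 - 2 * s * ((x i - a) / b) - 1 < 0} ≤
        2 * Fintype.card ι := by
  obtain ⟨⟨u, v⟩, hq, hbal⟩ :=
    exists_centerpoint (fun i => ((x i, x i ^ 2 + y i ^ 2) : ℝ × ℝ))
  have hfin : finrank ℝ (ℝ × ℝ) = 2 := by simp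
  rw [hfin] at hbal
  -- The centerpoint lies strictly above the parabola, hence is itself the lift of a point, `(u,
  -- b)`.
  have huv : u ^ 2 < v := by
    have hconv : Convex ℝ {p : ℝ × ℝ | p.1 ∈ Set.univ ∧ p.1 ^ 2 < p.2} :=
      (even_two.convexOn_pow (𝕜 := ℝ)).convex_strict_epigraph
    refine (convexHull_min ?_ hconv hq).2
    rintro _ ⟨i, rfl⟩
    exact ⟨trivial, by have := hy i; simp only; nlinarith⟩
  set b := Real.sqrt (v - u ^ 2) with hb
  have hbpos : 0 < b := Real.sqrt_pos.2 (by linarith)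
  have hb2 : b ^ 2 = v - u ^ 2 := Real.sq_sqrt (by linarith)
  refine ⟨u, b, hbpos, fun s => ?_⟩
  -- Its level line through `(u, v)` is the lift of the circle with center `u + s * b` through `(u,
  -- b)`.
  let g : ℝ × ℝ →ₗ[ℝ] ℝ := LinearMap.snd ℝ ℝ ℝ - (2 * (u + s * b)) • LinearMap.fst ℝ ℝ ℝ
  have hform : ∀ i, ((x i - u) / b) ^ 2 + (y i / b) ^ 2 - 2 * s * ((x i - u) / b) - 1 =
      (g (x i, x i ^ 2 + y i ^ 2) - g (u, v)) / b ^ 2 := by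
    intro i
    simp only [g, LinearMap.sub_apply, LinearMap.smul_apply, LinearMap.snd_apply,
      LinearMap.fst_apply, smul_eq_mul]
    rw [show v = b ^ 2 + u ^ 2 by linarith]
    field_simp
    ring
  have hb2pos : 0 < b ^ 2 := by positivity
  simp only [hform, div_pos_iff_of_pos_right hb2pos, sub_pos, div_neg_iff, hb2pos, hb2pos.le.not_gt,
    and_false, false_or, and_true, sub_neg]
  refine ⟨hbal g, ?_⟩
  simpa using hbal (-g)

/-! ### The logarithmic bound -/

/-- The bound of `card_near_circle_le` for a height inversely proportional to `n` is a multiple of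
`log n`. -/
theorem row_bound_le_mul_log {n : ℕ} (hn : 2 ≤ n) {c h N : ℝ} (hc : 0 < c) (hh : 0 < h) (hN : 0 ≤ N) :
    2 * N * ((Real.log 2 - Real.log (1 / (4 * c * n))) / h + 2) ≤
      2 * N * (((|Real.log 2 + Real.log (4 * c)| / Real.log 2) + 1) / h + 2 / Real.log 2) *
        Real.log n := by
  have hl2 : 0 < Real.log 2 := Real.log_pos (by norm_num)
  have hnpos : (0 : ℝ) < n := by exact_mod_cast (by omega : 0 < n)
  have hln : Real.log 2 ≤ Real.log n := Real.log_le_log (by norm_num) (by exact_mod_cast hn)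
  have h1 : 1 ≤ Real.log n / Real.log 2 := (one_le_div hl2).2 hln
  rw [one_div, Real.log_inv, Real.log_mul (by positivity) hnpos.ne', mul_assoc (2 * N)]
  refine mul_le_mul_of_nonneg_left ?_ (by positivity)
  calc (Real.log 2 - -(Real.log (4 * c) + Real.log n)) / h + 2
      ≤ (|Real.log 2 + Real.log (4 * c)| * (Real.log n / Real.log 2) + Real.log n) / h +
        2 * (Real.log n / Real.log 2) := by
        gcongr
        · have h2 := le_abs_self (Real.log 2 + Real.log (4 * c))
          have h3 := le_mul_of_one_le_right (abs_nonneg (Real.log 2 + Real.log (4 * c))) h1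
          linarith
        · linarith
    _ = _ := by field_simp

end HyperbolicGrid

open Finset HyperbolicGrid in
theorem theorem3 (r d : ℝ) (hr : 0 < r) :
    ∃ C : ℝ, ∀ (V : Type*) [Fintype V] (G : SimpleGraph V) (t : ℕ),
      2 ≤ Fintype.card V →
      HyperbolicGrid.IsHyperbolicGraph G r d →
      HyperbolicGrid.IsMinor (HyperbolicGrid.grid t) G →
      (t : ℝ) ≤ C * Real.log (Fintype.card V) := by
  have hσ : 0 < Real.cosh r - 1 := by linarith [Real.one_lt_cosh.2 hr.ne']
  set ε := Real.sqrt (Real.cosh r - 1) with hεdef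
  have hε : 0 < ε := Real.sqrt_pos.2 hσ
  have hε2 : ε ^ 2 = Real.cosh r - 1 := Real.sq_sqrt hσ.le
  set κ := Real.cosh d - 1 with hκdef
  have hκ : 0 ≤ κ := by linarith [Real.one_le_cosh d]
  set c := 16 * (2 * κ + 2) ^ 2 with hcdef
  have hc : 0 < c := by positivity
  have hc2 : 2 ≤ c := by nlinarith
  have hh : 0 < Real.log (1 + ε) := Real.log_pos (by linarith)
  set N : ℝ := ⌊c * (1 + ε) / ε⌋₊ + 1 with hN
  refine ⟨3 * (2 * N * (((|Real.log 2 + Real.log (4 * c)| / Real.log 2) + 1) / Real.log (1 + ε) +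
    2 / Real.log 2)), ?_⟩
  rintro V _ G t hcard ⟨m, hm⟩ ⟨B, hconn, hdisj, hadj⟩
  classical
  obtain rfl | ht := Nat.eq_zero_or_pos t
  · have : (1 : ℝ) ≤ Fintype.card V := by exact_mod_cast (by omega : 1 ≤ Fintype.card V)
    have := Real.log_nonneg this
    have := Real.log_pos one_lt_two
    rw [Nat.cast_zero]
    positivity
  have : NeZero t := ⟨ht.ne'⟩
  have : Nonempty V := Fintype.card_pos_iff.1 (by omega)
  choose w hw using fun x => Set.nonempty_coe_sort.1 (hconn x).nonempty
  obtain ⟨a, b, hb, hbal⟩ := exists_hyperbolic_center (fun i => (m (w i)).re)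
    (fun i => (m (w i)).im) fun i => (m (w i)).im_pos
  let x : V → ℝ := fun v => ((m v).re - a) / b
  let y : V → ℝ := fun v => (m v).im / b
  have hy : ∀ v, 0 < y v := fun v => div_pos (m v).im_pos hb
  have hdist : ∀ v v', 2 * (Real.cosh (dist (m v) (m v')) - 1) * (y v * y v') =
      (x v - x v') ^ 2 + (y v - y v') ^ 2 := by
    intro v v'
    have h1 := (m v).im_pos
    have h2 := (m v').im_pos
    rw [UpperHalfPlane.cosh_dist']
    simp only [x, y]
    field_simp
    ring
  have hsep : ∀ v v', v ≠ v' → 2 * ε ^ 2 * (y v * y v') ≤ (x v - x v') ^ 2 + (y v - y v') ^ 2 := by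
    intro v v' hne
    rw [← hdist, hε2]
    have h1 : Real.cosh r ≤ Real.cosh (dist (m v) (m v')) := by
      rw [Real.cosh_le_cosh, abs_of_pos hr, abs_of_nonneg dist_nonneg]
      exact (hm.separated v v' hne).le
    have := mul_pos (hy v) (hy v')
    gcongr
  have hshort : ∀ v v', G.Adj v v' → (x v - x v') ^ 2 + (y v - y v') ^ 2 ≤ 2 * κ * (y v * y v') := by
    intro v v' hvv
    rw [← hdist, hκdef]
    have h1 : Real.cosh (dist (m v) (m v')) ≤ Real.cosh d := by
      rw [Real.cosh_le_cosh, abs_of_nonneg dist_nonneg]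
      exact (hm.short v v' hvv).le.trans (le_abs_self d)
    have := mul_pos (hy v) (hy v')
    gcongr
  obtain ⟨s, hs0, hs1, hlow⟩ := exists_circle_avoiding_low_points x y hc
  let S : Finset V := {v | y v ≤ 2 ∧ -(c * y v) ≤ x v ^ 2 - 2 * s * x v - 1 ∧
    x v ^ 2 - 2 * s * x v - 1 ≤ 0}
  have hmemS : ∀ v, v ∈ S ↔ y v ≤ 2 ∧ -(c * y v) ≤ x v ^ 2 - 2 * s * x v - 1 ∧
    x v ^ 2 - 2 * s * x v - 1 ≤ 0 := fun v => by simp [S]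
  have hScard : (#S : ℝ) ≤ 2 * N *
      ((Real.log 2 - Real.log (1 / (4 * c * Fintype.card V))) / Real.log (1 + ε) + 2) := by
    have hV : (2 : ℝ) ≤ Fintype.card V := by exact_mod_cast hcard
    refine card_near_circle_le S x y (s := s) hε hc (by positivity) ?_ hsep (fun v hv => ?_) fun v hv => ?_
    · rw [div_le_iff₀ (by positivity)]
      nlinarith
    · obtain ⟨h1, h2, h3⟩ := (hmemS v).1 hv
      exact ⟨hlow v h2 h3, h1⟩
    · exact ((hmemS v).1 hv).2
  have cross : ∀ v v', v ∉ S → G.Adj v v' → 0 < x v' ^ 2 + y v' ^ 2 - 2 * s * x v' - 1 →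
      0 < x v ^ 2 + y v ^ 2 - 2 * s * x v - 1 := by
    intro v v' hv hvv hout
    by_contra! hin
    exact hv ((hmemS v).2
      (near_circle_of_crossing (hy v) hκ hs0 hs1 (hshort v v' hvv) hin hout))
  have hcardgrid : Fintype.card (Fin t × Fin t) = t ^ 2 := by
    rw [Fintype.card_prod, Fintype.card_fin, sq]
  have key : t ≤ 3 * #S := by
    refine le_three_mul_card_of_balanced hconn hdisj hadj hw S
      (fun v => 0 < x v ^ 2 + y v ^ 2 - 2 * s * x v - 1) ?_ ?_ ?_
    · intro v v' hv hv' hvv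
      exact ⟨cross v' v hv' hvv.symm, cross v v' hv hvv⟩
    · rw [← hcardgrid]
      refine le_trans (Nat.mul_le_mul_left 3 (card_le_card fun i hi => ?_)) (hbal s).1
      exact mem_filter.2 ⟨mem_univ _, (mem_filter.1 hi).2.2⟩
    · rw [← hcardgrid]
      refine le_trans (Nat.mul_le_mul_left 3 (card_le_card fun i hi => ?_)) (hbal s).2
      obtain ⟨h1, h2⟩ := (mem_filter.1 hi).2
      -- Points exactly on the circle belong to `S`: there `y² ≤ 2 * y ≤ c * y`.
      refine mem_filter.2 ⟨mem_univ _, (not_lt.1 h2).lt_of_ne fun h0 => h1 ((hmemS _).2 ?_)⟩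
      change x (w i) ^ 2 + y (w i) ^ 2 - 2 * s * x (w i) - 1 = 0 at h0
      have hpos := hy (w i)
      have hy2 : y (w i) ≤ 2 := by nlinarith [sq_nonneg (x (w i) - s)]
      exact ⟨hy2, by nlinarith, by nlinarith⟩
  calc (t : ℝ) ≤ 3 * #S := by exact_mod_cast key
    _ ≤ 3 * (2 * N * (((|Real.log 2 + Real.log (4 * c)| / Real.log 2) + 1) / Real.log (1 + ε) +
          2 / Real.log 2) * Real.log (Fintype.card V)) := by
        gcongr
        exact hScard.trans (row_bound_le_mul_log hcard hc hh (by positivity))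
    _ = _ := by ring
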